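/- Let $\overline{\mathbb{Q}}$ be an algebraic closure of $\mathbb{Q}$. For $c\in\mathbb{Q}$ let $f_c(x)=x^2+c$, and let $\mathrm{PrePer}(f_c)$ be the set of all $\alpha\in\overline{\mathbb{Q}}$ such that $f_c^n(\alpha)=f_c^m(\alpha)$ for some integers $0\le m<n$, where $f_c^n$ denotes the $n$-fold composition of $f_c$ with itself. Let $\mathbb{Q}^{\mathrm{tr}}\subseteq\overline{\mathbb{Q}}$ be the set of totally real algebraic numbers, that is, those whose minimal polynomial over $\mathbb{Q}$ splits completely over $\mathbb{R}$. Let $c$ be a rational number. (a) If $c>\frac14$, then $\mathrm{PrePer}(f_c)\cap\mathbb{Q}^{\mathrm{tr}}$ is empty. (b) If $-2<c\le\frac14$, then $\mathrm{PrePer}(f_c)\cap\mathbb{Q}^{\mathrm{tr}}$ is nonempty and finite. (c) If $c\le-2$, then $\mathrm{PrePer}(f_c)\subseteq\mathbb{Q}^{\mathrm{tr}}$; in particular, $\mathrm{PrePer}(f_c)\cap\mathbb{Q}^{\mathrm{tr}}$ is infinite. -/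

import Mathlib

/-- The quadratic polynomial map `f_c(x) = x ^ 2 + c` on a field `K` containing `ℚ`,
for a rational parameter `c`. -/
def quadMap (K : Type*) [Field K] [Algebra ℚ K] (c : ℚ) (x : K) : K :=
  x ^ 2 + algebraMap ℚ K c

/-- `PrePer(f_c)`, for `K` an algebraic closure of `ℚ`: the `α` with `f_c^n(α) = f_c^m(α)` for
some `0 ≤ m < n`, where `f_c^n` is the `n`-fold composition. -/
def prePer (K : Type*) [Field K] [Algebra ℚ K] (c : ℚ) : Set K :=
  {α | ∃ m n : ℕ, m < n ∧ (quadMap K c)^[n] α = (quadMap K c)^[m] α}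

/-- The set of totally real algebraic numbers in `K`: those whose minimal polynomial over `ℚ`
splits completely over `ℝ`. -/
def totallyRealNumbers (K : Type*) [Field K] [Algebra ℚ K] : Set K :=
  {α | IsAlgebraic ℚ α ∧ ((minpoly ℚ α).map (algebraMap ℚ ℝ)).Splits}

/-!
Write `f_c(x) = x ^ 2 + c`. The argument rests on a monotonicity principle and a capacity bound.

Whenever a real function `h` strictly increases along `f_c` above a threshold `t`, a preperiodic
point satisfies `h ≤ t` (`le_of_iterate_eq_iterate`). For `c > 1 / 4` the choice `h = id` shows that
`f_c` has no real preperiodic point at all. For `c ≤ 1 / 4` let `B` be the larger real fixed point;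
then `h = |·|` confines the real preperiodic points to `[-B, B]`. For `c ≤ -2` the choice `h(z) = |z
- B| + |z + B|` on `ℂ` confines all complex preperiodic points to the degenerate ellipse with foci
`±B`, that is, to the real segment `[-B, B]` (`exists_ofReal_eq_of_mem_prePer`). Since the
conjugates of a preperiodic point are preperiodic, this gives emptiness in the first range and total
reality in the last.

Finiteness for `-2 < c ≤ 1 / 4` is a Fekete-type capacity argument. Here `B < 2`, so `[-B, B]` has
capacity `B / 2 < 1`. Let `α` be a totally real preperiodic point of degree `d`, and let `b` be the
denominator of `c`. The monic polynomials `digitPoly c k` of degree `k`, products of at most `N`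
iterates of `f_c` when `k < 2 ^ N`, satisfy that `b ^ N * digitPoly c k (α)` is an algebraic
integer, because `b` times any preperiodic point is one. The discriminant of this family for `k < d`
is a nonzero integer, which bounds the Vandermonde determinant of the conjugates of `α` from below
by `b ^ (-N d)` with `N ≈ log₂ d` (`one_le_den_pow_mul_abs_det`). After rescaling the conjugates
into `[-2, 2]`, which `f_{-2}` preserves, the same polynomials for the parameter `-2` bound that
determinant from above by `(B / 2) ^ (d (d - 1) / 2)` up to a factor `exp (O (d log d))`
(`abs_det_vandermonde_le`). Hence `d` is bounded, and Northcott's theorem for algebraic integers of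
bounded degree and bounded conjugates, applied to `b α`, gives finiteness.
-/

open Polynomial

/-! ### Dynamics of quadratic maps -/

/-- If `h` strictly increases along `f` wherever it exceeds `t`, then `h ≤ t` at every preperiodic
point: otherwise `h` would be strictly increasing along the whole forward orbit. -/
theorem le_of_iterate_eq_iterate {X : Type*} {f : X → X} {h : X → ℝ} {t : ℝ}
    (hf : ∀ x, t < h x → h x < h (f x)) {x : X} {m n : ℕ} (hmn : m < n)
    (hx : f^[n] x = f^[m] x) : h x ≤ t := by
  by_contra! ht
  have key : ∀ k, t < h (f^[k] x) := by
    intro k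
    induction k with
    | zero => simpa using ht
    | succ k ih => rw [Function.iterate_succ_apply']; exact ih.trans (hf _ ih)
  have hs : StrictMono fun k => h (f^[k] x) := strictMono_nat_of_lt_succ fun k => by
    simp only [Function.iterate_succ_apply']
    exact hf _ (key k)
  exact absurd (congrArg h hx) (hs hmn).ne'

theorem map_quadMap {K L : Type*} [Field K] [Algebra ℚ K] [Field L] [Algebra ℚ L] (φ : K →ₐ[ℚ] L)
    (c : ℚ) (x : K) : φ (quadMap K c x) = quadMap L c (φ x) := by
  simp [quadMap]

theorem map_mem_prePer_iff {K L : Type*} [Field K] [Algebra ℚ K] [Field L] [Algebra ℚ L]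
    (φ : K →ₐ[ℚ] L) (c : ℚ) (x : K) : φ x ∈ prePer L c ↔ x ∈ prePer K c := by
  have h : Function.Semiconj φ (quadMap K c) (quadMap L c) := map_quadMap φ c
  refine exists_congr fun m => exists_congr fun n => and_congr_right fun _ => ?_
  rw [← (h.iterate_right n).eq, ← (h.iterate_right m).eq]
  exact φ.injective.eq_iff (a := (quadMap K c)^[n] x)

theorem quadMap_mem_prePer_iff {K : Type*} [Field K] [Algebra ℚ K] {c : ℚ} {x : K} :
    quadMap K c x ∈ prePer K c ↔ x ∈ prePer K c := by
  constructor
  · rintro ⟨m, n, h, e⟩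
    exact ⟨m + 1, n + 1, by omega, by simpa only [Function.iterate_succ_apply] using e⟩
  · rintro ⟨m, n, h, e⟩
    refine ⟨m, n, h, ?_⟩
    rw [← Function.iterate_succ_apply, ← Function.iterate_succ_apply,
      Function.iterate_succ_apply', e, Function.iterate_succ_apply']

/-- Over an algebraically closed field `f_c` maps its preperiodic points onto themselves. If there
were finitely many, it would be injective on them, and `f_c(-x) = f_c(x)` would leave only `x = 0`.
-/
theorem prePer_infinite {K : Type*} [Field K] [Algebra ℚ K] [IsAlgClosed K] {c : ℚ} (hc : c ≠ 0) :
    (prePer K c).Infinite := by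
  intro hfin
  have : CharZero K := algebraRat.charZero K
  obtain ⟨s, hs⟩ := IsAlgClosed.exists_pow_nat_eq (1 - 4 * algebraMap ℚ K c) (n := 2) (by norm_num)
  have hβ : (1 + s) / 2 ∈ prePer K c := by
    refine ⟨0, 1, one_pos, ?_⟩
    simp only [Function.iterate_one, Function.iterate_zero, id, quadMap]
    linear_combination hs / 4
  have hsurj : Set.SurjOn (quadMap K c) (prePer K c) (prePer K c) := by
    intro y hy
    obtain ⟨x, hx⟩ := IsAlgClosed.exists_pow_nat_eq (y - algebraMap ℚ K c) (n := 2) (by norm_num)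
    have hxy : quadMap K c x = y := by simp [quadMap, hx]
    exact ⟨x, quadMap_mem_prePer_iff.1 (hxy ▸ hy), hxy⟩
  have hinj : Set.InjOn (quadMap K c) (prePer K c) := by
    have := Finset.injOn_of_surjOn_of_card_le (s := hfin.toFinset) (t := hfin.toFinset)
      (quadMap K c) (fun x hx => by simpa [quadMap_mem_prePer_iff] using hx)
      (by simpa using hsurj) le_rfl
    simpa using this
  have hzero : ∀ x ∈ prePer K c, x = 0 := by
    intro x hx
    have hneg : quadMap K c (-x) = quadMap K c x := by simp [quadMap]
    have hx' : -x ∈ prePer K c :=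
      quadMap_mem_prePer_iff.1 (hneg ▸ quadMap_mem_prePer_iff.2 hx)
    exact neg_eq_self.1 (hinj hx' hx hneg)
  have h0 : (0 : K) ∈ prePer K c := hzero _ hβ ▸ hβ
  have := hzero _ (quadMap_mem_prePer_iff.2 h0)
  simp [quadMap, hc] at this

/-! ### Totally real numbers and complex embeddings -/

theorem mem_roots_map_minpoly_iff {K : Type*} [Field K] [Algebra ℚ K] [Algebra.IsAlgebraic ℚ K]
    (α : K) (z : ℂ) :
    z ∈ ((minpoly ℚ α).map (algebraMap ℚ ℂ)).roots ↔ ∃ φ : K →ₐ[ℚ] ℂ, φ α = z := by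
  rw [← Set.mem_range (f := fun φ : K →ₐ[ℚ] ℂ => φ α),
    Algebra.IsAlgebraic.range_eval_eq_rootSet_minpoly, mem_rootSet', mem_roots', IsRoot.def,
    eval_map_algebraMap]

/-- A number is totally real if and only if all its complex embeddings are real. This is the form in
which total reality is used below. -/
theorem mem_totallyRealNumbers_iff {K : Type*} [Field K] [Algebra ℚ K] [Algebra.IsAlgebraic ℚ K]
    {α : K} : α ∈ totallyRealNumbers K ↔ ∀ φ : K →ₐ[ℚ] ℂ, ∃ r : ℝ, φ α = r := by
  have hα : IsIntegral ℚ α := Algebra.IsIntegral.isIntegral α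
  have hmap : ((minpoly ℚ α).map (algebraMap ℚ ℝ)).map (algebraMap ℝ ℂ) =
      (minpoly ℚ α).map (algebraMap ℚ ℂ) := by
    rw [Polynomial.map_map, ← IsScalarTower.algebraMap_eq]
  constructor
  · rintro ⟨-, hs⟩ φ
    have hz := (mem_roots_map_minpoly_iff α (φ α)).2 ⟨φ, rfl⟩
    rw [← hmap] at hz
    rw [hs.roots_map] at hz
    obtain ⟨r, -, hr⟩ := Multiset.mem_map.1 hz
    exact ⟨r, by simpa using hr.symm⟩
  · intro h
    refine ⟨hα.isAlgebraic, Splits.of_splits_map_of_injective (i := algebraMap ℝ ℂ)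
      (algebraMap ℝ ℂ).injective (IsAlgClosed.splits _) ?_⟩
    intro z hz
    rw [hmap] at hz
    obtain ⟨φ, rfl⟩ := (mem_roots_map_minpoly_iff α z).1 hz
    obtain ⟨r, hr⟩ := h φ
    exact ⟨r, by simp [hr]⟩

theorem ofReal_mem_prePer_iff {c : ℚ} {r : ℝ} : (r : ℂ) ∈ prePer ℂ c ↔ r ∈ prePer ℝ c :=
  map_mem_prePer_iff (Complex.ofRealAm.restrictScalars ℚ) c r

theorem prePer_real_eq_empty {c : ℚ} (hc : 1 / 4 < c) : prePer ℝ c = ∅ := by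
  rw [Set.eq_empty_iff_forall_notMem]
  rintro x ⟨m, n, hmn, h⟩
  have hc' : (1 / 4 : ℝ) < c := by simpa using (Rat.cast_lt (K := ℝ)).2 hc
  -- `id` increases everywhere, so any threshold below `x` itself gives a contradiction
  have := le_of_iterate_eq_iterate (h := id) (t := x - 1) (fun y _ => ?_) hmn h
  · simp only [id] at this; linarith
  · simp only [id, quadMap, eq_ratCast]
    nlinarith [sq_nonneg (y - 1 / 2)]

/-- The larger of the two fixed points of `f_c` on `ℝ`; meaningful for `c ≤ 1 / 4` only, as the
square root takes the junk value `0` beyond. -/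
noncomputable def largeFixedPoint (c : ℚ) : ℝ := (1 + √(1 - 4 * c)) / 2

theorem largeFixedPoint_sq {c : ℚ} (hc : c ≤ 1 / 4) :
    largeFixedPoint c ^ 2 + c = largeFixedPoint c := by
  have hc' : (c : ℝ) ≤ 1 / 4 := by simpa using (Rat.cast_le (K := ℝ)).2 hc
  have := Real.sq_sqrt (show (0 : ℝ) ≤ 1 - 4 * c by linarith)
  unfold largeFixedPoint
  linarith

theorem half_le_largeFixedPoint (c : ℚ) : 1 / 2 ≤ largeFixedPoint c := by
  unfold largeFixedPoint
  linarith [Real.sqrt_nonneg (1 - 4 * (c : ℝ))]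

theorem abs_le_of_mem_prePer_real {c : ℚ} (hc : c ≤ 1 / 4) {x : ℝ} (hx : x ∈ prePer ℝ c) :
    |x| ≤ largeFixedPoint c := by
  obtain ⟨m, n, hmn, h⟩ := hx
  have hB := largeFixedPoint_sq hc
  have hB' := half_le_largeFixedPoint c
  refine le_of_iterate_eq_iterate (h := fun y => |y|) (fun y hy => ?_) hmn h
  simp only [quadMap, eq_ratCast]
  refine lt_of_lt_of_le ?_ (le_abs_self _)
  rw [← sq_abs y]
  nlinarith

/-- The ellipse with foci `±B` and major axis `2 * B` degenerates to a real segment. -/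
theorem exists_ofReal_eq_of_norm_add_norm_le {B : ℝ} {z : ℂ}
    (h : ‖z - B‖ + ‖z + B‖ ≤ 2 * B) : ∃ r : ℝ, z = r := by
  have h1 : ‖z - B‖ ^ 2 = (z.re - B) ^ 2 + z.im ^ 2 := by
    rw [Complex.sq_norm, Complex.normSq_apply]; simp; ring
  have h2 : ‖z + B‖ ^ 2 = (z.re + B) ^ 2 + z.im ^ 2 := by
    rw [Complex.sq_norm, Complex.normSq_apply]; simp; ring
  have h3 := norm_nonneg (z - B)
  have h4 := norm_nonneg (z + B)
  refine ⟨z.re, Complex.ext rfl ?_⟩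
  simp only [Complex.ofReal_im]
  by_contra him
  have him2 : 0 < z.im ^ 2 := by positivity
  have h5 : |z.re - B| < ‖z - B‖ := by
    apply abs_lt_of_sq_lt_sq _ h3
    linarith
  have h6 : |z.re + B| < ‖z + B‖ := by
    apply abs_lt_of_sq_lt_sq _ h4
    linarith
  have := neg_abs_le (z.re - B)
  have := le_abs_self (z.re + B)
  linarith

/-- For `c ≤ -2` all complex preperiodic points are real. With `B` the larger fixed point and
`h(z) = |z - B| + |z + B|`, one has `f_c(z) - B = (z - B) (z + B)` and
`|f_c(z) + B| ≥ |z| ^ 2 - (B ^ 2 - 2 * B)`, so that the parallelogram law gives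
`h(f_c(z)) - h(z) ≥ (h(z) - 2 * B) * (h(z) + 2 * B - 2) / 2`, which is positive for
`h(z) > 2 * B`. -/
theorem exists_ofReal_eq_of_mem_prePer {c : ℚ} (hc : c ≤ -2) {z : ℂ} (hz : z ∈ prePer ℂ c) :
    ∃ r : ℝ, z = r := by
  obtain ⟨m, n, hmn, h⟩ := hz
  set B := largeFixedPoint c with hBdef
  have hB : B ^ 2 + c = B := largeFixedPoint_sq (by linarith)
  have hc' : (c : ℝ) ≤ -2 := by exact_mod_cast hc
  have hB2 : 2 ≤ B := by
    have := half_le_largeFixedPoint c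
    nlinarith
  refine exists_ofReal_eq_of_norm_add_norm_le (B := B) ?_
  refine le_of_iterate_eq_iterate (h := fun y : ℂ => ‖y - B‖ + ‖y + B‖) (fun y hy => ?_) hmn h
  have hBc : (c : ℂ) = B - B ^ 2 := by
    have : (c : ℝ) = B - B ^ 2 := by linarith
    exact_mod_cast congrArg (fun x : ℝ => (x : ℂ)) this
  have e1 : quadMap ℂ c y - B = (y - B) * (y + B) := by
    simp only [quadMap, eq_ratCast, hBc]; ring
  have e2 : quadMap ℂ c y + B = y ^ 2 - (B ^ 2 - 2 * B : ℝ) := by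
    simp only [quadMap, eq_ratCast, hBc]; push_cast; ring
  -- `0 ≤ B ^ 2 - 2 * B` is where `c ≤ -2` enters, in the form `2 ≤ B`
  have e3 : ‖y‖ ^ 2 - (B ^ 2 - 2 * B) ≤ ‖quadMap ℂ c y + B‖ := by
    rw [e2]
    have := norm_sub_norm_le (y ^ 2) ((B ^ 2 - 2 * B : ℝ) : ℂ)
    rwa [norm_pow, Complex.norm_real, Real.norm_of_nonneg (by nlinarith)] at this
  have e4 := parallelogram_law_with_norm ℝ y (B : ℂ)
  rw [Complex.norm_real, Real.norm_of_nonneg (by linarith)] at e4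
  rw [e1, norm_mul]
  nlinarith [norm_nonneg (y - B), norm_nonneg (y + B)]

/-! ### Integrality of preperiodic points -/

/-- The monic integer polynomial of degree `2 ^ n` obtained from the `n`-th iterate of `x ^ 2 + a /
b` by clearing denominators: its value at `b * x` is `b ^ (2 ^ n)` times that iterate at `x`. -/
noncomputable def scaledIterate (a b : ℤ) : ℕ → ℤ[X]
  | 0 => X
  | n + 1 => (X ^ 2 + C (a * b ^ (2 ^ (n + 1) - 1))).comp (scaledIterate a b n)

theorem natDegree_scaledIterate (a b : ℤ) (n : ℕ) : (scaledIterate a b n).natDegree = 2 ^ n := by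
  induction n with
  | zero => simp [scaledIterate]
  | succ n ih => rw [scaledIterate, natDegree_comp, natDegree_X_pow_add_C, ih, pow_succ']

theorem monic_scaledIterate (a b : ℤ) (n : ℕ) : (scaledIterate a b n).Monic := by
  induction n with
  | zero => exact monic_X
  | succ n ih =>
    refine (monic_X_pow_add_C _ two_ne_zero).comp ih ?_
    rw [natDegree_scaledIterate]
    positivity

theorem aeval_scaledIterate {K : Type*} [Field K] [Algebra ℚ K] (c : ℚ) (n : ℕ) (x : K) :
    aeval ((c.den : K) * x) (scaledIterate c.num c.den n) =
      (c.den : K) ^ 2 ^ n * (quadMap K c)^[n] x := by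
  have := algebraRat.charZero K
  have hb : (c.den : K) ≠ 0 := Nat.cast_ne_zero.2 c.den_nz
  have hc : (c.num : K) = c.den * algebraMap ℚ K c := by
    rw [← map_natCast (algebraMap ℚ K), ← map_mul, Rat.den_mul_eq_num, map_intCast]
  induction n with
  | zero => simp [scaledIterate]
  | succ n ih =>
    have hpow : (c.den : K) ^ 2 ^ (n + 1) = c.den * c.den ^ (2 ^ (n + 1) - 1) := by
      rw [← pow_succ', Nat.sub_add_cancel Nat.one_le_two_pow]
    rw [scaledIterate, aeval_comp, ih, Function.iterate_succ_apply']
    rw [map_add, map_pow, aeval_X, aeval_C, quadMap]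
    simp only [algebraMap_int_eq, eq_intCast, Int.cast_mul, Int.cast_pow, Int.cast_natCast]
    rw [mul_add, mul_pow, ← pow_mul, ← pow_succ, hpow, hc]
    ring

theorem isIntegral_den_mul {K : Type*} [Field K] [Algebra ℚ K] {c : ℚ} {x : K}
    (hx : x ∈ prePer K c) : IsIntegral ℤ ((c.den : K) * x) := by
  obtain ⟨m, n, hmn, h⟩ := hx
  have hlt : 2 ^ m < 2 ^ n := Nat.pow_lt_pow_right one_lt_two hmn
  refine ⟨scaledIterate c.num c.den n -
    C ((c.den : ℤ) ^ (2 ^ n - 2 ^ m)) * scaledIterate c.num c.den m, ?_, ?_⟩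
  · refine (monic_scaledIterate _ _ n).sub_of_left (degree_lt_degree ?_)
    refine (natDegree_C_mul_le _ _).trans_lt ?_
    rwa [natDegree_scaledIterate, natDegree_scaledIterate]
  · rw [← aeval_def, map_sub, map_mul, aeval_C, aeval_scaledIterate, aeval_scaledIterate, h]
    simp only [map_pow, algebraMap_int_eq, eq_intCast, Int.cast_natCast]
    rw [← mul_assoc, ← pow_add, Nat.sub_add_cancel hlt.le, sub_self]

/-! ### A basis of monic polynomials adapted to the iteration -/

/-- The product of the iterates `f_c^i(x)` over the positions `i` of the binary digits `1` of `k`,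
a monic polynomial of degree `k`. The recursion splits off the last digit, since the remaining
factors are the product for `k / 2` evaluated at `f_c(x)`. -/
noncomputable def digitPoly (c : ℚ) : ℕ → ℚ[X]
  | 0 => 1
  | k + 1 => X ^ ((k + 1) % 2) * (digitPoly c ((k + 1) / 2)).comp (X ^ 2 + C c)
decreasing_by omega

theorem monic_digitPoly_and_natDegree (c : ℚ) (k : ℕ) :
    (digitPoly c k).Monic ∧ (digitPoly c k).natDegree = k := by
  induction k using Nat.strong_induction_on with
  | _ k ih =>
    cases k with
    | zero => simp [digitPoly]
    | succ k =>
      obtain ⟨h1, h2⟩ := ih ((k + 1) / 2) (by omega)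
      have h3 : ((digitPoly c ((k + 1) / 2)).comp (X ^ 2 + C c)).Monic :=
        h1.comp (monic_X_pow_add_C _ two_ne_zero) (by rw [natDegree_X_pow_add_C]; norm_num)
      rw [digitPoly]
      refine ⟨(monic_X_pow _).mul h3, ?_⟩
      rw [(monic_X_pow _).natDegree_mul h3, natDegree_X_pow, natDegree_comp, h2,
        natDegree_X_pow_add_C]
      omega

theorem aeval_digitPoly_succ {K : Type*} [Field K] [Algebra ℚ K] (c : ℚ) (k : ℕ) (x : K) :
    aeval x (digitPoly c (k + 1)) =
      x ^ ((k + 1) % 2) * aeval (quadMap K c x) (digitPoly c ((k + 1) / 2)) := by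
  rw [digitPoly, map_mul, aeval_comp]
  simp [quadMap]

/-- A property of the values `digitPoly c k (x)` for `x` in an `f_c`-stable set `S`, at level `N`
when `k < 2 ^ N`, follows if it holds for `1` at level `0` and passes from level `N` to level `N +
1` under multiplication by `1` and by elements of `S`. -/
theorem aeval_digitPoly_induction {K : Type*} [Field K] [Algebra ℚ K] {c : ℚ} {S : Set K}
    (hS : Set.MapsTo (quadMap K c) S S) {P : ℕ → K → Prop} (h1 : P 0 1)
    (hmono : ∀ N y, P N y → P (N + 1) y)
    (hmul : ∀ N, ∀ x ∈ S, ∀ y, P N y → P (N + 1) (x * y)) (N : ℕ) :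
    ∀ k < 2 ^ N, ∀ x ∈ S, P N (aeval x (digitPoly c k)) := by
  induction N with
  | zero =>
    intro k hk x _
    obtain rfl : k = 0 := by simpa using hk
    simpa [digitPoly] using h1
  | succ N ih =>
    intro k hk x hx
    cases k with
    | zero =>
      have := hmono N _ (ih 0 (by positivity) x hx)
      simpa [digitPoly] using this
    | succ k =>
      rw [aeval_digitPoly_succ]
      have h := ih ((k + 1) / 2) (by rw [pow_succ] at hk; omega) _ (hS hx)
      rcases Nat.mod_two_eq_zero_or_one (k + 1) with h0 | h0
      · rw [h0, pow_zero, one_mul]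
        exact hmono N _ h
      · rw [h0, pow_one]
        exact hmul N x hx _ h

theorem isIntegral_den_pow_mul_aeval_digitPoly {K : Type*} [Field K] [Algebra ℚ K] {c : ℚ} {N k : ℕ}
    (hk : k < 2 ^ N) {x : K} (hx : x ∈ prePer K c) :
    IsIntegral ℤ ((c.den : K) ^ N * aeval x (digitPoly c k)) := by
  refine aeval_digitPoly_induction (S := prePer K c)
    (P := fun N y => IsIntegral ℤ ((c.den : K) ^ N * y))
    (fun y hy => quadMap_mem_prePer_iff.2 hy) ?_ ?_ ?_ N k hk x hx
  · simpa using isIntegral_one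
  · intro N y hy
    rw [pow_succ', mul_assoc]
    have := (isIntegral_algebraMap (R := ℤ) (A := K) (x := (c.den : ℤ))).mul hy
    simpa using this
  · intro N x hx y hy
    have := (isIntegral_den_mul hx).mul hy
    convert! this using 1
    ring

theorem abs_aeval_digitPoly_neg_two_le {N k : ℕ} (hk : k < 2 ^ N) {x : ℝ} (hx : |x| ≤ 2) :
    |aeval x (digitPoly (-2) k)| ≤ 2 ^ N := by
  refine aeval_digitPoly_induction (S := {x : ℝ | |x| ≤ 2}) (P := fun N y => |y| ≤ 2 ^ N)
    ?_ ?_ ?_ ?_ N k hk x hx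
  · intro y hy
    have h2 : y ^ 2 ≤ 2 ^ 2 := sq_le_sq.2 (by simpa using hy)
    simp only [Set.mem_ofPred_eq, quadMap, eq_ratCast, Rat.cast_neg, Rat.cast_ofNat, abs_le]
    constructor <;> nlinarith [sq_nonneg y]
  · simp
  · intro N y hy
    refine hy.trans ?_
    gcongr <;> simp
  · intro N x hx y hy
    rw [abs_mul, pow_succ']
    exact mul_le_mul hx hy (abs_nonneg _) zero_le_two

/-! ### Bounding the degree -/

theorem det_vandermonde_eq_det_digitPoly {K : Type*} [Field K] [Algebra ℚ K] (c : ℚ) {d : ℕ}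
    (v : Fin d → K) : (Matrix.vandermonde v).det =
      (Matrix.of fun i j : Fin d => aeval (v i) (digitPoly c j)).det := by
  rw [Matrix.det_eval_matrixOfPolynomials_eq_det_vandermonde v
    (fun j => (digitPoly c j).map (algebraMap ℚ K))]
  · simp only [eval_map_algebraMap]
  · intro i
    rw [natDegree_map, (monic_digitPoly_and_natDegree c i).2]
  · exact fun i => (monic_digitPoly_and_natDegree c i).1.map _

/-- Upper bound for a Vandermonde determinant with nodes in `[-2 * q, 2 * q]`. The power of `q`
comes from rescaling to `[-2, 2]`; there the monomials are replaced by the monic polynomials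
`digitPoly (-2) j`, which are bounded by `2 ^ N` because `f_{-2}` preserves `[-2, 2]`. -/
theorem abs_det_vandermonde_le {d N : ℕ} (hN : d ≤ 2 ^ N) {q : ℝ} (hq : 0 < q) {v : Fin d → ℝ}
    (hv : ∀ i, |v i| ≤ 2 * q) :
    |(Matrix.vandermonde v).det| ≤ q ^ (∑ j ∈ Finset.range d, j) * (d.factorial * (2 ^ N) ^ d) := by
  have h1 : Matrix.vandermonde v =
      Matrix.of fun i j : Fin d => q ^ (j : ℕ) * Matrix.vandermonde (fun i => v i / q) i j := by
    ext i j
    simp only [Matrix.vandermonde_apply, Matrix.of_apply, div_pow]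
    field_simp
  rw [h1, Matrix.det_mul_row, abs_mul, Finset.prod_pow_eq_pow_sum, abs_of_pos (pow_pos hq _),
    Fin.sum_univ_eq_sum_range (fun j => j), det_vandermonde_eq_det_digitPoly (-2)]
  gcongr
  have := Matrix.det_le (abv := AbsoluteValue.abs (S := ℝ)) (x := 2 ^ N)
    (A := Matrix.of fun i j : Fin d => aeval (v i / q) (digitPoly (-2) j)) fun i j => ?_
  · simpa using this
  · refine abs_aeval_digitPoly_neg_two_le (j.2.trans_le hN) ?_
    rw [abs_div, abs_of_pos hq, div_le_iff₀ hq]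
    exact hv i

/-- Lower bound for the Vandermonde determinant of the conjugates of a preperiodic generator `α` of
`L`, all assumed real: its product with `b ^ (N * d)`, where `b` is the denominator of `c`, has as
its square the discriminant of the integral family `b ^ N * digitPoly c k (α)`, a nonzero integer.
-/
theorem one_le_den_pow_mul_abs_det {L : Type*} [Field L] [Algebra ℚ L] [FiniteDimensional ℚ L]
    {c : ℚ} {α : L} (hα : α ∈ prePer L c) (hgen : Algebra.adjoin ℚ {α} = ⊤) {d N : ℕ}
    (hN : d ≤ 2 ^ N) (e : Fin d ≃ (L →ₐ[ℚ] ℂ)) {r : Fin d → ℝ} (hr : ∀ i, e i α = r i) :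
    1 ≤ ((c.den : ℝ) ^ N) ^ d * |(Matrix.vandermonde r).det| := by
  set w : Fin d → L := fun k => (c.den : L) ^ N * aeval α (digitPoly c k) with hw
  have hint : IsIntegral ℤ (Algebra.discr ℚ w) :=
    Algebra.discr_isIntegral ℚ fun k => isIntegral_den_pow_mul_aeval_digitPoly (k.2.trans_le hN) hα
  obtain ⟨D, hD⟩ := IsIntegrallyClosed.isIntegral_iff.1 hint
  have hdiscr := Algebra.discr_eq_det_embeddingsMatrixReindex_pow_two ℚ ℂ w e
  have hmat : Algebra.embeddingsMatrixReindex ℚ ℂ w e =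
      (Matrix.of fun i j : Fin d => (c.den : ℂ) ^ N *
        ((Matrix.of fun i j : Fin d => aeval (r i) (digitPoly c j)).map
          Complex.ofReal) i j).transpose := by
    ext i j
    have : ((aeval (r j) (digitPoly c i) : ℝ) : ℂ) = aeval (r j : ℂ) (digitPoly c i) :=
      (aeval_algebraMap_apply ℂ (r j) (digitPoly c i)).symm
    simp [Algebra.embeddingsMatrixReindex, Algebra.embeddingsMatrix, hw, this, ← hr,
      aeval_algHom_apply]
  have hdet : (Algebra.embeddingsMatrixReindex ℚ ℂ w e).det =
      ((((c.den : ℝ) ^ N) ^ d * (Matrix.vandermonde r).det : ℝ) : ℂ) := by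
    rw [hmat, Matrix.det_transpose, Matrix.det_mul_row, det_vandermonde_eq_det_digitPoly c]
    have := (Complex.ofRealHom.map_det
      (Matrix.of fun i j : Fin d => aeval (r i) (digitPoly c j)))
    simp only [RingHom.mapMatrix_apply] at this
    push_cast
    simp only [Finset.prod_const, Finset.card_univ, Fintype.card_fin]
    congr 1
    exact this.symm
  have hinj : Function.Injective r := by
    intro i j hij
    apply e.injective
    have : (e i) α = (e j) α := by rw [hr, hr, hij]
    exact AlgHom.ext_of_adjoin_eq_top hgen (by simpa using this)
  have hne : (Matrix.vandermonde r).det ≠ 0 := Matrix.det_vandermonde_ne_zero_iff.2 hinj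
  have hDeq : (D : ℝ) = (((c.den : ℝ) ^ N) ^ d * (Matrix.vandermonde r).det) ^ 2 := by
    rw [hdet, ← hD] at hdiscr
    have : ((D : ℝ) : ℂ) = (((((c.den : ℝ) ^ N) ^ d * (Matrix.vandermonde r).det) ^ 2 : ℝ) : ℂ) := by
      push_cast
      push_cast at hdiscr
      simpa using hdiscr
    exact_mod_cast this
  have hb : (0 : ℝ) < c.den := by exact_mod_cast c.den_pos
  have hpos : (0 : ℝ) < D := by
    rw [hDeq]
    have : ((c.den : ℝ) ^ N) ^ d * (Matrix.vandermonde r).det ≠ 0 :=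
      mul_ne_zero (by positivity) hne
    positivity
  have h1 : (1 : ℝ) ≤ D := by exact_mod_cast Int.cast_pos.1 hpos
  rw [hDeq, one_le_sq_iff_one_le_abs, abs_mul, abs_of_pos (by positivity)] at h1
  exact h1

/-- The lower and the upper bound for the Vandermonde determinant are incompatible for large `d`:
the square of the right-hand side is at most `((2 * d) ^ (2 * (b + 2)) * q ^ (d - 1)) ^ d`, whose
base tends to `0`. -/
theorem eventually_not_one_le {q : ℝ} (hq : 0 < q) (hq1 : q < 1) (b : ℕ) :
    ∀ᶠ d : ℕ in Filter.atTop, ∀ N : ℕ, 2 ^ N ≤ 2 * d →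
      ¬ 1 ≤ ((b : ℝ) ^ N) ^ d * (q ^ (∑ j ∈ Finset.range d, j) * (d.factorial * (2 ^ N) ^ d)) := by
  -- any exponent `s` with `b ≤ 2 ^ s` serves to bound `b ^ N` by `(2 * d) ^ s`; take `s = b`
  have hs : b ≤ 2 ^ b := Nat.lt_two_pow_self.le
  have hlim := (tendsto_pow_const_mul_const_pow_of_abs_lt_one (2 * (b + 2))
    (abs_lt.2 ⟨by linarith, hq1⟩)).const_mul ((2 : ℝ) ^ (2 * (b + 2)))
  rw [mul_zero] at hlim
  filter_upwards [hlim.eventually (gt_mem_nhds hq), Filter.eventually_gt_atTop 0]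
    with d hd hd0 N hN h1
  have hN' : (2 : ℝ) ^ N ≤ 2 * d := by exact_mod_cast hN
  have hbN : (b : ℝ) ^ N ≤ (2 * d) ^ b := by
    calc (b : ℝ) ^ N ≤ (2 ^ b) ^ N := by gcongr; exact_mod_cast hs
      _ = (2 ^ N) ^ b := by rw [← pow_mul, ← pow_mul, mul_comm]
      _ ≤ (2 * d) ^ b := by gcongr
  have hfac : (d.factorial : ℝ) ≤ (2 * d) ^ d := by
    calc (d.factorial : ℝ) ≤ (d : ℝ) ^ d := by exact_mod_cast Nat.factorial_le_pow d
      _ ≤ (2 * d) ^ d := by gcongr; linarith [(Nat.cast_nonneg d : (0 : ℝ) ≤ d)]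
  have h2 : 1 ≤ ((2 * d : ℝ) ^ (b + 2)) ^ d * q ^ (∑ j ∈ Finset.range d, j) := by
    refine h1.trans ?_
    calc _ ≤ ((2 * d : ℝ) ^ b) ^ d *
          (q ^ (∑ j ∈ Finset.range d, j) * ((2 * d) ^ d * (2 * d) ^ d)) := by gcongr
      _ = _ := by rw [pow_add, pow_two, mul_pow (_ ^ b), mul_pow (2 * d : ℝ) _ d]; ring
  have h3 : 1 ≤ ((2 * d : ℝ) ^ (2 * (b + 2)) * q ^ (d - 1)) ^ d := by
    calc (1 : ℝ) ≤ (((2 * d : ℝ) ^ (b + 2)) ^ d * q ^ (∑ j ∈ Finset.range d, j)) ^ 2 :=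
          one_le_pow₀ h2
      _ = _ := by
          rw [mul_pow _ (q ^ _) 2, mul_pow _ (q ^ _) d, ← pow_mul q, ← pow_mul q,
            Finset.sum_range_id_mul_two, mul_comm d (d - 1)]
          congr 1
          rw [← pow_mul, ← pow_mul, ← pow_mul]
          congr 1
          ring
  have h4 : 1 ≤ (2 * d : ℝ) ^ (2 * (b + 2)) * q ^ (d - 1) := by
    by_contra! hlt
    exact absurd h3 (not_le.2 (pow_lt_one₀ (by positivity) hlt hd0.ne'))
  have h5 : q ≤ (2 : ℝ) ^ (2 * (b + 2)) * ((d : ℝ) ^ (2 * (b + 2)) * q ^ d) := by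
    calc q = 1 * q := (one_mul q).symm
      _ ≤ ((2 * d : ℝ) ^ (2 * (b + 2)) * q ^ (d - 1)) * q := by gcongr
      _ = _ := by
        rw [mul_assoc, ← pow_succ, Nat.sub_add_cancel hd0, mul_pow, mul_assoc]
  exact absurd hd (not_lt.2 h5)

theorem largeFixedPoint_lt_two {c : ℚ} (hc : -2 < c) (hc' : c ≤ 1 / 4) :
    largeFixedPoint c < 2 := by
  have h1 := largeFixedPoint_sq hc'
  have h2 := half_le_largeFixedPoint c
  have h3 : (-2 : ℝ) < c := by simpa using (Rat.cast_lt (K := ℝ)).2 hc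
  nlinarith

theorem exists_mem_prePer_real {K : Type*} [Field K] [Algebra ℚ K] [Algebra.IsAlgebraic ℚ K]
    {c : ℚ} {α : K} (hα : α ∈ prePer K c ∩ totallyRealNumbers K) (φ : K →ₐ[ℚ] ℂ) :
    ∃ r ∈ prePer ℝ c, φ α = r := by
  obtain ⟨r, hr⟩ := mem_totallyRealNumbers_iff.1 hα.2 φ
  refine ⟨r, ?_, hr⟩
  rw [← ofReal_mem_prePer_iff, ← hr, map_mem_prePer_iff]
  exact hα.1

/-- A simple field extension generated by `α`, as an abstract field rather than as a subfield of
`K`: this keeps its `ℚ`-algebra structure from competing with the one that every division ring of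
characteristic zero carries. -/
theorem exists_powerBasis.{u} {K : Type u} [Field K] [Algebra ℚ K] [Algebra.IsAlgebraic ℚ K] (α : K) :
    ∃ (L : Type u) (_ : Field L) (_ : Algebra ℚ L) (ι : L →ₐ[ℚ] K) (pb : PowerBasis ℚ L),
      ι pb.gen = α ∧ pb.dim = (minpoly ℚ α).natDegree := by
  have hα : IsIntegral ℚ α := Algebra.IsIntegral.isIntegral α
  exact ⟨_, _, _, (IntermediateField.adjoin ℚ {α}).val, IntermediateField.adjoin.powerBasis hα,
    by simp [IntermediateField.adjoin.powerBasis], rfl⟩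

/-- The degrees of the totally real preperiodic points are bounded when `-2 < c ≤ 1 / 4`. -/
theorem exists_natDegree_minpoly_lt (K : Type*) [Field K] [Algebra ℚ K] [Algebra.IsAlgebraic ℚ K]
    {c : ℚ} (hc : -2 < c) (hc' : c ≤ 1 / 4) :
    ∃ D : ℕ, ∀ α ∈ prePer K c ∩ totallyRealNumbers K, (minpoly ℚ α).natDegree < D := by
  set q := largeFixedPoint c / 2 with hqdef
  have hq : 0 < q := by have := half_le_largeFixedPoint c; positivity
  have hq1 : q < 1 := by have := largeFixedPoint_lt_two hc hc'; linarith
  obtain ⟨D, hD⟩ := Filter.eventually_atTop.1 (eventually_not_one_le hq hq1 c.den)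
  refine ⟨D, fun α hα => ?_⟩
  by_contra! hlt
  obtain ⟨L, _, _, ι, pb, hι, hd⟩ := exists_powerBasis α
  have : FiniteDimensional ℚ L := pb.finite
  set d := (minpoly ℚ α).natDegree
  have hd0 : 0 < d := minpoly.natDegree_pos (Algebra.IsIntegral.isIntegral α)
  have hcard : Fintype.card (L →ₐ[ℚ] ℂ) = Fintype.card (Fin d) := by
    rw [AlgHom.card, pb.finrank, hd, Fintype.card_fin]
  let e := (Fintype.equivOfCardEq hcard).symm
  have hpre : pb.gen ∈ prePer L c := by
    rw [← map_mem_prePer_iff ι, hι]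
    exact hα.1
  have hreal : ∀ i, ∃ r ∈ prePer ℝ c, e i pb.gen = r := by
    intro i
    obtain ⟨φ, hφ⟩ := (mem_roots_map_minpoly_iff α (e i pb.gen)).1 (by
      rw [← hι, minpoly.algHom_eq ι ι.injective, mem_roots',
        IsRoot.def, eval_map_algebraMap, aeval_algHom_apply, minpoly.aeval, map_zero]
      exact ⟨map_ne_zero (minpoly.ne_zero (Algebra.IsIntegral.isIntegral pb.gen)), rfl⟩)
    obtain ⟨r, hr, h⟩ := exists_mem_prePer_real hα φ
    exact ⟨r, hr, hφ ▸ h⟩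
  choose r hr her using hreal
  -- `N = d.size`, the number of binary digits of `d`, satisfies `d ≤ 2 ^ N ≤ 2 * d`
  have h2N : 2 ^ d.size ≤ 2 * d := by
    obtain ⟨N, hN⟩ := Nat.exists_eq_add_of_lt (Nat.size_pos.2 hd0)
    have := Nat.lt_size.1 (show N < d.size by omega)
    rw [hN, zero_add, pow_succ']
    omega
  have hdN : d ≤ 2 ^ d.size := (Nat.lt_size_self d).le
  refine hD d hlt d.size h2N ?_
  refine (one_le_den_pow_mul_abs_det hpre pb.adjoin_gen_eq_top hdN e her).trans ?_
  gcongr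
  refine abs_det_vandermonde_le hdN hq fun i => ?_
  rw [hqdef, mul_div_cancel₀ _ two_ne_zero]
  exact abs_le_of_mem_prePer_real hc' (hr i)

/-! ### Finiteness -/

/-- Northcott's theorem for algebraic integers, without fixing a number field that contains them. -/
theorem finite_isIntegral_natDegree_le_norm_le (K : Type*) [Field K] [Algebra ℚ K]
    [Algebra.IsAlgebraic ℚ K] (D : ℕ) (R : ℝ) :
    {x : K | IsIntegral ℤ x ∧ (minpoly ℚ x).natDegree ≤ D ∧
      ∀ φ : K →ₐ[ℚ] ℂ, ‖φ x‖ ≤ R}.Finite := by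
  classical
  have := algebraRat.charZero K
  let C : ℕ := ⌈max R 1 ^ D * D.choose (D / 2)⌉₊
  refine (bUnion_roots_finite (algebraMap ℤ K) D (Set.finite_Icc (-C : ℤ) C)).subset ?_
  rintro x ⟨hx, hdeg, hnorm⟩
  have hroots : ∀ z ∈ ((minpoly ℚ x).map (algebraMap ℚ ℂ)).roots, ‖z‖ ≤ R := by
    intro z hz
    obtain ⟨φ, rfl⟩ := (mem_roots_map_minpoly_iff x z).1 hz
    exact hnorm φ
  have hmap := minpoly.isIntegrallyClosed_eq_field_fractions' ℚ hx
  simp_rw [Set.mem_iUnion]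
  refine ⟨minpoly ℤ x, ⟨?_, fun i => ?_⟩, mem_rootSet.2 ⟨minpoly.ne_zero hx, minpoly.aeval ℤ x⟩⟩
  · rwa [← (minpoly.monic hx).natDegree_map (algebraMap ℤ ℚ), ← hmap]
  · rw [Set.mem_Icc, ← abs_le, ← @Int.cast_le ℝ]
    refine (Eq.trans_le ?_ <| coeff_bdd_of_roots_le (algebraMap ℚ ℂ)
      (minpoly.monic hx.tower_top) (IsAlgClosed.splits _) hdeg hroots i).trans (Nat.le_ceil _)
    rw [hmap, coeff_map, coeff_map]
    simp

theorem finite_prePer_inter_totallyRealNumbers (K : Type*) [Field K] [Algebra ℚ K]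
    [Algebra.IsAlgebraic ℚ K] {c : ℚ} (hc : -2 < c) (hc' : c ≤ 1 / 4) :
    (prePer K c ∩ totallyRealNumbers K).Finite := by
  have := algebraRat.charZero K
  have hb : (c.den : K) ≠ 0 := Nat.cast_ne_zero.2 c.den_nz
  obtain ⟨D, hD⟩ := exists_natDegree_minpoly_lt K hc hc'
  refine ((finite_isIntegral_natDegree_le_norm_le K D (c.den * largeFixedPoint c)).preimage
    (mul_right_injective₀ hb).injOn).subset ?_
  intro α hα
  refine ⟨isIntegral_den_mul hα.1, ?_, ?_⟩
  · refine le_trans ?_ (hD α hα).le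
    obtain ⟨L, _, _, ι, pb, hι, hd⟩ := exists_powerBasis α
    have : FiniteDimensional ℚ L := pb.finite
    rw [← hd, ← pb.finrank]
    have h := minpoly.natDegree_le (A := ℚ) ((c.den : L) * pb.gen)
    rwa [← minpoly.algHom_eq ι ι.injective, map_mul, map_natCast, hι] at h
  · intro φ
    obtain ⟨r, hr, h⟩ := exists_mem_prePer_real hα φ
    have := abs_le_of_mem_prePer_real hc' hr
    rw [map_mul, map_natCast, h, norm_mul, Complex.norm_real, Complex.norm_natCast,
      Real.norm_eq_abs]
    gcongr

theorem nonempty_prePer_inter_totallyRealNumbers (K : Type*) [Field K] [Algebra ℚ K]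
    [Algebra.IsAlgebraic ℚ K] [IsAlgClosed K] {c : ℚ} (hc : c ≤ 1 / 4) :
    (prePer K c ∩ totallyRealNumbers K).Nonempty := by
  have := algebraRat.charZero K
  obtain ⟨s, hs⟩ := IsAlgClosed.exists_pow_nat_eq (1 - 4 * algebraMap ℚ K c) (n := 2) (by norm_num)
  refine ⟨(1 + s) / 2, ⟨0, 1, one_pos, ?_⟩, mem_totallyRealNumbers_iff.2 fun φ => ?_⟩
  · simp only [Function.iterate_one, Function.iterate_zero, id, quadMap]
    linear_combination hs / 4
  · have hc' : (c : ℝ) ≤ 1 / 4 := by simpa using (Rat.cast_le (K := ℝ)).2 hc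
    have hsq : φ s ^ 2 = (√(1 - 4 * c) : ℂ) ^ 2 := by
      rw [← Complex.ofReal_pow, Real.sq_sqrt (by linarith), ← map_pow, hs,
        map_sub, map_mul, map_one, map_ofNat, AlgHom.commutes]
      simp
    rcases sq_eq_sq_iff_eq_or_eq_neg.1 hsq with h | h
    · exact ⟨(1 + √(1 - 4 * c)) / 2, by simp [h, map_ofNat φ 2]⟩
    · exact ⟨(1 - √(1 - 4 * c)) / 2, by simp [h, map_ofNat φ 2, sub_eq_add_neg]⟩

/-! ### The three ranges of the parameter -/

theorem theorem3p2 (K : Type*) [Field K] [Algebra ℚ K] [IsAlgClosure ℚ K] (c : ℚ) :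
    (1 / 4 < c → prePer K c ∩ totallyRealNumbers K = ∅) ∧
    (-2 < c ∧ c ≤ 1 / 4 →
      (prePer K c ∩ totallyRealNumbers K).Nonempty ∧
      (prePer K c ∩ totallyRealNumbers K).Finite) ∧
    (c ≤ -2 →
      prePer K c ⊆ totallyRealNumbers K ∧
      (prePer K c ∩ totallyRealNumbers K).Infinite) := by
  have : Algebra.IsAlgebraic ℚ K := IsAlgClosure.isAlgebraic
  have : IsAlgClosed K := IsAlgClosure.isAlgClosed ℚ
  refine ⟨fun hc => ?_, fun ⟨hc, hc'⟩ => ⟨?_, ?_⟩, fun hc => ?_⟩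
  · rw [Set.eq_empty_iff_forall_notMem]
    intro α hα
    obtain ⟨r, hr, -⟩ := exists_mem_prePer_real hα (IsAlgClosed.lift : K →ₐ[ℚ] ℂ)
    rwa [prePer_real_eq_empty hc] at hr
  · exact nonempty_prePer_inter_totallyRealNumbers K hc'
  · exact finite_prePer_inter_totallyRealNumbers K hc hc'
  · have hsub : prePer K c ⊆ totallyRealNumbers K := fun α hα =>
      mem_totallyRealNumbers_iff.2 fun φ =>
        exists_ofReal_eq_of_mem_prePer hc ((map_mem_prePer_iff φ c α).2 hα)
    rw [Set.inter_eq_left.2 hsub]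
    exact ⟨hsub, prePer_infinite (by linarith)⟩
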